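/- For a matrix $A\in\mathbb C^{n\times n}$ whose spectrum $\sigma(A)$ is disjoint from the imaginary axis and for $t\in\mathbb R$, $t\neq0$, Green's function of the bounded solutions problem for $x'(t)=Ax(t)+f(t)$ is $$\mathcal G(A,t)=\frac1{2\pi i}\int_\Gamma g_t(\lambda)(\lambda\mathbf 1-A)^{-1}\,d\lambda ,$$ where, for $\operatorname{Re}\lambda<0$, $g_t(\lambda)=e^{\lambda t}$ if $t>0$ and $g_t(\lambda)=0$ if $t<0$; for $\operatorname{Re}\lambda>0$, $g_t(\lambda)=0$ if $t>0$ and $g_t(\lambda)=-e^{\lambda t}$ if $t<0$; and $\Gamma$ is any contour (a finite system of closed curves) that lies in $\{\operatorname{Re}\lambda\ne0\}\setminus\sigma(A)$ and encloses $\sigma(A)$, i.e. has winding number $1$ about each point of $\sigma(A)$. Let a complex triangular (upper or lower) matrix $B$ of size $n\times n$ be represented as $B=D+N$ with $D$ diagonal and $N$ strictly triangular. Let $\gamma^->0$ and $\gamma^+>0$ be such that the strip $\{z\in\mathbb C:\,-\gamma^-<\operatorname{Re}z<\gamma^+\}$ is disjoint from $\sigma(B)$, and put $\gamma=\gamma^-+\gamma^+$.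 Then for every $t\neq0$ $$|\mathcal G(B,t)|\le\bigl(\eta(t)e^{-\gamma^-t}+\eta(-t)e^{\gamma^+t}\bigr)\sum_{k=0}^{n-1}|N|^{k}\,\frac{|t|^{k}\sqrt{\gamma|t|}\,e^{\gamma|t|/2}K_{-k-\frac12}\left(\frac12\gamma|t|\right)}{\sqrt\pi\,k!}.$$ Here $|A|$ is the matrix of the absolute values $|a_{ij}|$ of the entries of $A$, the inequality between matrices is entrywise, $\eta(t)=1$ for $t>0$ and $\eta(t)=0$ for $t<0$, and $K_\nu(x)=\int_0^\infty e^{-x\cosh u}\cosh(\nu u)\,du$ ($x>0$) is the modified Bessel function of the second kind. -/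

import Mathlib

noncomputable section

namespace GreenEstimate

/-- `exp_t^+(z)`: it is `e^{zt}` for `t > 0` and `0` for `t < 0` (only used for `t ≠ 0`). -/
def expPlus (t : ℝ) (z : ℂ) : ℂ := if 0 < t then Complex.exp (z * t) else 0

/-- `exp_t^-(z)`: it is `0` for `t > 0` and `-e^{zt}` for `t < 0` (only used for `t ≠ 0`). -/
def expMinus (t : ℝ) (z : ℂ) : ℂ := if 0 < t then 0 else -Complex.exp (z * t)

/-- `g_t(z)`: it is `exp_t^-(z)` for `re z > 0` and `exp_t^+(z)` for `re z < 0`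
(only used for `t ≠ 0` and `re z ≠ 0`). -/
def g (t : ℝ) (z : ℂ) : ℂ := if 0 < z.re then expMinus t z else expPlus t z

/-- An oriented closed rectifiable curve in `ℂ`, parametrized by `[a, b]`. The regularity covers
every piecewise `C¹` closed curve. -/
structure ClosedCurve where
  a : ℝ
  b : ℝ
  a_le_b : a ≤ b
  toFun : ℝ → ℂ
  continuousOn : ContinuousOn toFun (Set.Icc a b)
  differentiableAt : ∃ S : Set ℝ, S.Countable ∧
    ∀ s ∈ Set.Ioo a b \ S, DifferentiableAt ℝ toFun s
  integrable_deriv : IntervalIntegrable (deriv toFun) MeasureTheory.volume a b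
  closed : toFun a = toFun b

/-- The integral of `f` along a closed curve. -/
def ClosedCurve.integral (γ : ClosedCurve) (f : ℂ → ℂ) : ℂ :=
  ∫ s in γ.a..γ.b, deriv γ.toFun s * f (γ.toFun s)

/-- A contour consists of finitely many closed curves. -/
structure Contour where
  m : ℕ
  curve : Fin m → ClosedCurve

/-- The contour integral `∫_Γ f(z) dz`. -/
def Contour.integral (Γ : Contour) (f : ℂ → ℂ) : ℂ := ∑ l, (Γ.curve l).integral f

/-- The winding number of the contour about `w`. -/
def Contour.winding (Γ : Contour) (w : ℂ) : ℂ :=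
  (2 * Real.pi * Complex.I)⁻¹ * Γ.integral (fun z => (z - w)⁻¹)

/-- `Γ` lies in the domain `{re z ≠ 0}` of the functions `g t`, does not meet `S`, and goes around
each point of `S` exactly once counterclockwise. (The two components of the domain are convex, so
`Γ` automatically has winding number `0` about the points outside the domain.) -/
structure Contour.Encloses (Γ : Contour) (S : Set ℂ) : Prop where
  re_ne_zero : ∀ l, ∀ s ∈ Set.Icc (Γ.curve l).a (Γ.curve l).b, ((Γ.curve l).toFun s).re ≠ 0
  notMem : ∀ l, ∀ s ∈ Set.Icc (Γ.curve l).a (Γ.curve l).b, (Γ.curve l).toFun s ∉ S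
  winding_eq_one : ∀ w ∈ S, Γ.winding w = 1

/-- Green's function
`𝒢(A, t) = (2πi)⁻¹ ∫_Γ g_t(z) (z 1 - A)⁻¹ dz`, `t ≠ 0`,
where the contour `Γ` encloses the spectrum of `A`; the integral is taken entrywise. -/
def green {n : ℕ} (Γ : Contour) (A : Matrix (Fin n) (Fin n) ℂ) (t : ℝ) :
    Matrix (Fin n) (Fin n) ℂ :=
  Matrix.of fun i j => (2 * Real.pi * Complex.I)⁻¹ *
    Γ.integral (fun z => g t z * (z • (1 : Matrix (Fin n) (Fin n) ℂ) - A)⁻¹ i j)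

/-- The modified Bessel function of the second kind `K_ν(x)`, for `x > 0` and real order `ν`. -/
def besselK (ν x : ℝ) : ℝ :=
  ∫ u in Set.Ioi (0 : ℝ), Real.exp (-x * Real.cosh u) * Real.cosh (ν * u)

/-- The Heaviside function, used for `t ≠ 0` only. -/
def heaviside (t : ℝ) : ℝ := if 0 < t then 1 else 0

/-- The matrix of the absolute values of the entries. -/
def absMatrix {n : ℕ} (A : Matrix (Fin n) (Fin n) ℂ) : Matrix (Fin n) (Fin n) ℝ :=
  A.map (fun z => ‖z‖)

/-- All the nonzero entries are strictly above, or all are strictly below, the diagonal. -/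
def IsStrictlyTriangular {n : ℕ} (N : Matrix (Fin n) (Fin n) ℂ) : Prop :=
  (∀ i j, j ≤ i → N i j = 0) ∨ (∀ i j, i ≤ j → N i j = 0)

/-- A circle as a closed curve. -/
def circle (c : ℂ) (R : ℝ) : ClosedCurve where
  a := 0
  b := 2 * Real.pi
  a_le_b := by positivity
  toFun := circleMap c R
  continuousOn := (continuous_circleMap c R).continuousOn
  differentiableAt := ⟨∅, Set.countable_empty, fun s _ => differentiable_circleMap c R s⟩
  integrable_deriv := by
    have : deriv (circleMap c R) = fun s => circleMap 0 R s * Complex.I := by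
      ext s; simp
    rw [this]
    exact ((continuous_circleMap 0 R).mul continuous_const).intervalIntegrable _ _
  closed := by simp [circleMap]

theorem circle_integral (c : ℂ) (R : ℝ) (f : ℂ → ℂ) :
    (circle c R).integral f = circleIntegral f c R := by
  simp [ClosedCurve.integral, circleIntegral, circle]

theorem circle_integral_in {c w : ℂ} {R : ℝ} (h : w ∈ Metric.ball c R) :
    (circle c R).integral (fun z => (z - w)⁻¹) = 2 * Real.pi * Complex.I := by
  rw [circle_integral, circleIntegral.integral_sub_inv_of_mem_ball h]

theorem circle_integral_out {c w : ℂ} {R : ℝ} (hR : 0 ≤ R) (h : w ∉ Metric.closedBall c R) :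
    (circle c R).integral (fun z => (z - w)⁻¹) = 0 := by
  rw [circle_integral]
  have hne : ∀ z ∈ Metric.closedBall c R, z - w ≠ 0 := fun z hz h0 =>
    h (by rwa [sub_eq_zero.1 h0] at hz)
  apply Complex.circleIntegral_eq_zero_of_differentiable_on_off_countable hR Set.countable_empty
  · exact ContinuousOn.inv₀ (by fun_prop) hne
  · intro z hz
    exact DifferentiableAt.inv (by fun_prop) (hne z (Metric.ball_subset_closedBall hz.1))

/-- Every spectrum that does not meet the imaginary axis is enclosed by some contour. -/
theorem exists_encloses {n : ℕ} (A : Matrix (Fin n) (Fin n) ℂ)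
    (hA : ∀ z ∈ spectrum ℂ A, z.re ≠ 0) : ∃ Γ : Contour, Γ.Encloses (spectrum ℂ A) := by
  have hfin : (spectrum ℂ A).Finite := Matrix.finite_spectrum A
  obtain ⟨M, hM⟩ : ∃ M : ℝ, ∀ z ∈ spectrum ℂ A, ‖z‖ ≤ M := hfin.isBounded.exists_norm_le
  obtain ⟨δ, hδ, hδz⟩ : ∃ δ > 0, ∀ z ∈ spectrum ℂ A, δ ≤ |z.re| := by
    rcases (spectrum ℂ A).eq_empty_or_nonempty with h | h
    · exact ⟨1, one_pos, by simp [h]⟩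
    · obtain ⟨w, hw, hmin⟩ := Set.exists_min_image _ (fun z : ℂ => |z.re|) hfin h
      exact ⟨|w.re|, abs_pos.2 (hA w hw), hmin⟩
  obtain ⟨R, hR⟩ := exists_gt (M ^ 2 / δ + δ)
  have h0 : 0 ≤ M ^ 2 / δ := by positivity
  have hRδ : δ < R := by linarith
  have hMR : M ^ 2 < R * δ := by
    have : M ^ 2 / δ < R := by linarith
    rwa [div_lt_iff₀ hδ] at this
  have hr : 0 ≤ R - δ / 2 := by linarith
  -- the sign `e` selects the half-plane
  have key : ∀ e : ℝ, (e = 1 ∨ e = -1) → ∀ z ∈ spectrum ℂ A, 0 < e * z.re →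
      z ∈ Metric.ball ((e * R : ℝ) : ℂ) (R - δ / 2) := by
    intro e he z hz hpos
    have h1 : δ ≤ e * z.re := by
      have := hδz z hz
      rcases he with rfl | rfl
      · rwa [abs_of_pos (by linarith), ← one_mul z.re] at this
      · rw [abs_of_neg (by linarith)] at this
        linarith
    have h3 : z.re * z.re + z.im * z.im ≤ M ^ 2 := by
      have h4 : ‖z‖ ^ 2 ≤ M ^ 2 := pow_le_pow_left₀ (norm_nonneg z) (hM z hz) 2
      rwa [Complex.sq_norm, Complex.normSq_apply] at h4
    rw [Metric.mem_ball, dist_eq_norm]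
    refine lt_of_pow_lt_pow_left₀ 2 hr ?_
    rw [Complex.sq_norm, Complex.normSq_apply]
    simp only [Complex.sub_re, Complex.sub_im, Complex.ofReal_re, Complex.ofReal_im]
    have h5 := mul_le_mul_of_nonneg_left h1 (by linarith : 0 ≤ R)
    have h6 : e * e = 1 := by rcases he with rfl | rfl <;> norm_num
    have h7 : (z.re - e * R) * (z.re - e * R)
        = z.re * z.re - 2 * (R * (e * z.re)) + R * R := by
      linear_combination (R * R) * h6
    nlinarith
  have sep : ∀ e : ℝ, (e = 1 ∨ e = -1) →
      ∀ z ∈ Metric.closedBall ((e * R : ℝ) : ℂ) (R - δ / 2), 0 < e * z.re := by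
    intro e he z hz
    rw [Metric.mem_closedBall, dist_eq_norm] at hz
    have h1 := abs_le.1 ((Complex.abs_re_le_norm _).trans hz)
    simp only [Complex.sub_re, Complex.ofReal_re] at h1
    rcases he with rfl | rfl <;> linarith [h1.1, h1.2]
  let e : Fin 2 → ℝ := ![1, -1]
  have he : ∀ l, e l = 1 ∨ e l = -1 := by
    intro l; fin_cases l <;> simp [e]
  have hmem : ∀ l s, circleMap ((e l * R : ℝ) : ℂ) (R - δ / 2) s ∈
      Metric.sphere ((e l * R : ℝ) : ℂ) (R - δ / 2) := fun l s => circleMap_mem_sphere _ hr s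
  refine ⟨⟨2, fun l => circle ((e l * R : ℝ) : ℂ) (R - δ / 2)⟩, ?_, ?_, ?_⟩
  · intro l s _ h
    have := sep _ (he l) _ (Metric.sphere_subset_closedBall (hmem l s))
    rw [show (circleMap ((e l * R : ℝ) : ℂ) (R - δ / 2) s).re = 0 from h] at this
    simp at this
  · intro l s _ h
    have h1 := sep _ (he l) _ (Metric.sphere_subset_closedBall (hmem l s))
    exact (Metric.mem_sphere.1 (hmem l s)).not_lt (Metric.mem_ball.1 (key _ (he l) _ h h1))
  · intro w hw
    have h2 : (2 * Real.pi * Complex.I : ℂ) ≠ 0 := Complex.two_pi_I_ne_zero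
    have hin : ∀ l, 0 < e l * w.re → (circle ((e l * R : ℝ) : ℂ) (R - δ / 2)).integral
        (fun z => (z - w)⁻¹) = 2 * Real.pi * Complex.I :=
      fun l h => circle_integral_in (key _ (he l) w hw h)
    have hout : ∀ l, ¬ 0 < e l * w.re → (circle ((e l * R : ℝ) : ℂ) (R - δ / 2)).integral
        (fun z => (z - w)⁻¹) = 0 :=
      fun l h => circle_integral_out hr fun hc => h (sep _ (he l) w hc)
    simp only [Contour.winding, Contour.integral, Fin.sum_univ_two]
    have e0 : e 0 = 1 := rfl
    have e1 : e 1 = -1 := rfl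
    rcases lt_or_gt_of_ne (hA w hw) with h | h
    · rw [hout 0 (by rw [e0]; linarith), hin 1 (by rw [e1]; linarith), zero_add,
        inv_mul_cancel₀ h2]
    · rw [hin 0 (by rw [e0]; linarith), hout 1 (by rw [e1]; linarith), add_zero,
        inv_mul_cancel₀ h2]

end GreenEstimate

end

noncomputable section

namespace GreenEstimate

open MeasureTheory Set Filter Topology

/-! For `t > 0` only the left half-plane contributes. Off the spectrum the resolvent of `D + N` is
the finite Neumann sum of `(R N)^k R` over `k < n`, with `R` the resolvent of `D`, because `R N` is
strictly triangular and hence nilpotent. Each entry of `(R N)^k R` is a sum over paths of `k` steps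
of a product of `k` entries of `N` times `∏ (z - d)⁻¹` over the `k + 1` diagonal entries visited. So
everything reduces to a scalar bound, uniform in the points: the sum of the left residues of `e^{τz}
∏ (z - d)⁻¹` over `k + 1` points outside the strip is at most `e^{-ατ}` times a polynomial in `τ`
depending only on `k` and the width `α + β` (`norm_leftResidue_le`).

As a function of `τ`, this residue sum `f` satisfies `f' = c f + r`, where `r` is the residue sum
with the point `c` removed. A left point is handled by integrating forward from `τ = 0`, where the
value is known: `1` for one left point, `0` for several. A right point is handled by integrating
backward from infinity, since `f` stays bounded while `e^{-cs}` decays. The forward steps give `τ^k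
/ k!`; the backward steps preserve the larger polynomials `besselPoly`, thanks to a differential
inequality that is Pascal's rule.

These polynomials are the Bessel terms of the statement: the substitution `s = sinh (u/2)` turns `K`
of half-integer order into Gaussian moments. For `t < 0`, the reflection `z ↦ -z` exchanges the
half-planes and the two gaps. -/

/-! ### Calculus of contour integrals. -/

/-- The set of points of a closed curve. -/
def ClosedCurve.image (c : ClosedCurve) : Set ℂ := c.toFun '' Icc c.a c.b

/-- The set of points of a contour. -/
def Contour.image (Γ : Contour) : Set ℂ := ⋃ l, (Γ.curve l).image

theorem ClosedCurve.isCompact_image (c : ClosedCurve) : IsCompact c.image :=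
  isCompact_Icc.image_of_continuousOn c.continuousOn

theorem Contour.isCompact_image (Γ : Contour) : IsCompact Γ.image :=
  isCompact_iUnion fun l => (Γ.curve l).isCompact_image

theorem ClosedCurve.mem_image (c : ClosedCurve) {s : ℝ} (hs : s ∈ Icc c.a c.b) :
    c.toFun s ∈ c.image := mem_image_of_mem _ hs

theorem Contour.image_subset (Γ : Contour) (l : Fin Γ.m) : (Γ.curve l).image ⊆ Γ.image :=
  subset_iUnion (fun l => (Γ.curve l).image) l

theorem Contour.mem_image (Γ : Contour) (l : Fin Γ.m) {s : ℝ}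
    (hs : s ∈ Icc (Γ.curve l).a (Γ.curve l).b) : (Γ.curve l).toFun s ∈ Γ.image :=
  Γ.image_subset l ((Γ.curve l).mem_image hs)

theorem ClosedCurve.intervalIntegrable (c : ClosedCurve) {f : ℂ → ℂ}
    (hf : ContinuousOn f c.image) :
    IntervalIntegrable (fun s => deriv c.toFun s * f (c.toFun s)) volume c.a c.b := by
  refine c.integrable_deriv.mul_continuousOn ?_
  rw [uIcc_of_le c.a_le_b]
  exact hf.comp c.continuousOn fun s hs => c.mem_image hs

theorem ClosedCurve.integral_eq_zero_of_hasDerivAt (c : ClosedCurve) {F f : ℂ → ℂ}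
    (hf : ContinuousOn f c.image) (hF : ∀ z ∈ c.image, HasDerivAt F (f z) z) :
    c.integral f = 0 := by
  obtain ⟨S, hS, hd⟩ := c.differentiableAt
  have hFc : ContinuousOn F c.image := fun z hz => (hF z hz).continuousAt.continuousWithinAt
  have h := MeasureTheory.integral_eq_of_hasDerivAt_off_countable_of_le
    (f := fun s => F (c.toFun s)) (f' := fun s => deriv c.toFun s * f (c.toFun s)) c.a_le_b hS
    (hFc.comp c.continuousOn fun s hs => c.mem_image hs)
    (fun s hs => by
      have h1 := (hd s hs).hasDerivAt
      have h2 := hF _ (c.mem_image (Ioo_subset_Icc_self hs.1))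
      have h3 := h2.scomp s h1
      simpa [Function.comp_def] using h3)
    (c.intervalIntegrable hf)
  rw [ClosedCurve.integral, h, c.closed, sub_self]

theorem Contour.integral_eq_zero_of_hasDerivAt (Γ : Contour) {F f : ℂ → ℂ}
    (hf : ContinuousOn f Γ.image) (hF : ∀ z ∈ Γ.image, HasDerivAt F (f z) z) :
    Γ.integral f = 0 :=
  Finset.sum_eq_zero fun l _ => (Γ.curve l).integral_eq_zero_of_hasDerivAt
    (hf.mono (Γ.image_subset l)) fun z hz => hF z (Γ.image_subset l hz)

theorem Contour.integral_congr (Γ : Contour) {f g : ℂ → ℂ} (h : EqOn f g Γ.image) :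
    Γ.integral f = Γ.integral g := by
  refine Finset.sum_congr rfl fun l _ => intervalIntegral.integral_congr fun s hs => ?_
  rw [uIcc_of_le (Γ.curve l).a_le_b] at hs
  simp only [h (Γ.mem_image l hs)]

theorem Contour.integral_const_mul (Γ : Contour) (a : ℂ) (f : ℂ → ℂ) :
    Γ.integral (fun z => a * f z) = a * Γ.integral f := by
  simp only [Contour.integral, ClosedCurve.integral, Finset.mul_sum,
    ← intervalIntegral.integral_const_mul]
  refine Finset.sum_congr rfl fun l _ => intervalIntegral.integral_congr fun s _ => ?_
  ring

theorem Contour.integral_sub (Γ : Contour) {f g : ℂ → ℂ} (hf : ContinuousOn f Γ.image)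
    (hg : ContinuousOn g Γ.image) :
    Γ.integral (fun z => f z - g z) = Γ.integral f - Γ.integral g := by
  simp only [Contour.integral, ClosedCurve.integral, ← Finset.sum_sub_distrib]
  refine Finset.sum_congr rfl fun l _ => ?_
  rw [← intervalIntegral.integral_sub
    ((Γ.curve l).intervalIntegrable (hf.mono (Γ.image_subset l)))
    ((Γ.curve l).intervalIntegrable (hg.mono (Γ.image_subset l)))]
  simp only [mul_sub]

theorem Contour.integral_finset_sum (Γ : Contour) {ι : Type*} (s : Finset ι) {f : ι → ℂ → ℂ}
    (hf : ∀ i ∈ s, ContinuousOn (f i) Γ.image) :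
    Γ.integral (fun z => ∑ i ∈ s, f i z) = ∑ i ∈ s, Γ.integral (f i) := by
  simp only [Contour.integral, ClosedCurve.integral, Finset.mul_sum]
  rw [Finset.sum_comm]
  refine Finset.sum_congr rfl fun l _ => ?_
  exact intervalIntegral.integral_finsetSum fun i hi =>
    (Γ.curve l).intervalIntegrable ((hf i hi).mono (Γ.image_subset l))

/-- An upper bound for the integrals along `Γ` of the functions bounded by `1` there. -/
def Contour.length (Γ : Contour) : ℝ :=
  ∑ l, ∫ s in (Γ.curve l).a..(Γ.curve l).b, ‖deriv (Γ.curve l).toFun s‖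

theorem Contour.norm_integral_le (Γ : Contour) {f : ℂ → ℂ} {C : ℝ}
    (hf : ∀ z ∈ Γ.image, ‖f z‖ ≤ C) : ‖Γ.integral f‖ ≤ C * Γ.length := by
  rw [Contour.length, Finset.mul_sum]
  refine (norm_sum_le _ _).trans (Finset.sum_le_sum fun l _ => ?_)
  rw [← intervalIntegral.integral_const_mul]
  refine intervalIntegral.norm_integral_le_of_norm_le (Γ.curve l).a_le_b
    (ae_of_all _ fun s hs => ?_) ((Γ.curve l).integrable_deriv.norm.const_mul C)
  rw [norm_mul, mul_comm]
  exact mul_le_mul_of_nonneg_right (hf _ (Γ.mem_image l (Ioc_subset_Icc_self hs))) (norm_nonneg _)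

/-- Differentiation under the integral sign, with a domination valid for parameters within distance
`1` of `τ`: the curve is compact, so `z` and `f` are bounded on it. -/
theorem ClosedCurve.hasDerivAt_integral_exp (c : ClosedCurve) {f : ℂ → ℂ}
    (hf : ContinuousOn f c.image) (τ : ℝ) :
    HasDerivAt (fun τ : ℝ => c.integral fun z => Complex.exp (z * τ) * f z)
      (c.integral fun z => z * (Complex.exp (z * τ) * f z)) τ := by
  obtain ⟨C, hC⟩ := c.isCompact_image.exists_bound_of_continuousOn hf
  obtain ⟨M, hM⟩ := c.isCompact_image.exists_bound_of_continuousOn continuousOn_id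
  have hint : ∀ σ : ℝ, IntervalIntegrable
      (fun s => deriv c.toFun s * (Complex.exp (c.toFun s * σ) * f (c.toFun s))) volume c.a c.b :=
    fun σ => c.intervalIntegrable (f := fun z => Complex.exp (z * σ) * f z)
      ((by fun_prop : Continuous fun z : ℂ => Complex.exp (z * σ)).continuousOn.mul hf)
  have hint' : IntervalIntegrable
      (fun s => deriv c.toFun s * (c.toFun s * (Complex.exp (c.toFun s * τ) * f (c.toFun s))))
      volume c.a c.b :=
    c.intervalIntegrable (f := fun z => z * (Complex.exp (z * τ) * f z))
      (continuousOn_id.mul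
        ((by fun_prop : Continuous fun z : ℂ => Complex.exp (z * τ)).continuousOn.mul hf))
  refine (intervalIntegral.hasDerivAt_integral_of_dominated_loc_of_deriv_le
    (F' := fun (σ : ℝ) s => deriv c.toFun s * (c.toFun s * (Complex.exp (c.toFun s * σ) * f (c.toFun s))))
    (bound := fun s => ‖deriv c.toFun s‖ * (M * (Real.exp (M * (|τ| + 1)) * C)))
    (Metric.ball_mem_nhds τ one_pos) (Eventually.of_forall fun σ => (hint σ).def'.1)
    (hint τ) hint'.def'.1 (ae_of_all _ fun s hs σ hσ => ?_)
    (c.integrable_deriv.norm.mul_const _) (ae_of_all _ fun s _ σ _ => ?_)).2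
  · rw [uIoc_of_le c.a_le_b] at hs
    have hz := c.mem_image (Ioc_subset_Icc_self hs)
    have h1 : ‖c.toFun s‖ ≤ M := hM _ hz
    have hM0 : 0 ≤ M := (norm_nonneg _).trans h1
    rw [norm_mul, norm_mul, norm_mul]
    have h2 : ‖Complex.exp (c.toFun s * σ)‖ ≤ Real.exp (M * (|τ| + 1)) := by
      refine (Complex.norm_exp_le_exp_norm _).trans (Real.exp_le_exp.2 ?_)
      rw [norm_mul, Complex.norm_real, Real.norm_eq_abs]
      have : |σ| ≤ |τ| + 1 := by
        rw [Metric.mem_ball, Real.dist_eq] at hσ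
        have := abs_sub_abs_le_abs_sub σ τ
        linarith
      gcongr
    have h3 := hC _ hz
    gcongr
  · have h1 : HasDerivAt (fun σ : ℝ => c.toFun s * (σ : ℂ)) (c.toFun s) σ := by
      simpa using (Complex.ofRealCLM.hasDerivAt (x := σ)).const_mul (c.toFun s)
    refine (((h1.cexp.mul_const (f (c.toFun s))).const_mul (deriv c.toFun s))).congr_deriv ?_
    ring

theorem Contour.hasDerivAt_integral_exp (Γ : Contour) {f : ℂ → ℂ}
    (hf : ContinuousOn f Γ.image) (τ : ℝ) :
    HasDerivAt (fun τ : ℝ => Γ.integral fun z => Complex.exp (z * τ) * f z)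
      (Γ.integral fun z => z * (Complex.exp (z * τ) * f z)) τ :=
  HasDerivAt.fun_sum fun l _ =>
    (Γ.curve l).hasDerivAt_integral_exp (hf.mono (Γ.image_subset l)) τ

/-! ### Reflection of contours in the origin. -/

/-- The reflection of a closed curve in the origin. -/
def ClosedCurve.reflect (c : ClosedCurve) : ClosedCurve where
  a := c.a
  b := c.b
  a_le_b := c.a_le_b
  toFun := fun s => -c.toFun s
  continuousOn := c.continuousOn.neg
  differentiableAt := by
    obtain ⟨S, hS, hd⟩ := c.differentiableAt
    exact ⟨S, hS, fun s hs => (hd s hs).neg⟩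
  integrable_deriv := by
    have : deriv (fun s => -c.toFun s) = fun s => -deriv c.toFun s := by
      ext s; exact deriv.fun_neg
    rw [this]
    exact c.integrable_deriv.neg
  closed := by rw [c.closed]

/-- The reflection of a contour in the origin. -/
def Contour.reflect (Γ : Contour) : Contour := ⟨Γ.m, fun l => (Γ.curve l).reflect⟩

theorem Contour.reflect_integral (Γ : Contour) (f : ℂ → ℂ) :
    Γ.reflect.integral f = -Γ.integral fun z => f (-z) := by
  rw [Contour.integral, Contour.integral, ← Finset.sum_neg_distrib]
  refine Finset.sum_congr rfl fun l _ => ?_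
  simp only [ClosedCurve.integral, Contour.reflect, ClosedCurve.reflect, deriv.fun_neg, neg_mul,
    intervalIntegral.integral_neg]

/-- Winding numbers survive because both `dz` and `(z - w)⁻¹` change sign. -/
theorem Contour.Encloses.reflect {Γ : Contour} {S : Set ℂ} (h : Γ.Encloses S) :
    Γ.reflect.Encloses (-S) where
  re_ne_zero l s hs := by
    have := h.re_ne_zero l s hs
    simpa [Contour.reflect, ClosedCurve.reflect] using this
  notMem l s hs := by
    have := h.notMem l s hs
    simpa [Contour.reflect, ClosedCurve.reflect] using this
  winding_eq_one w hw := by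
    rw [← h.winding_eq_one (-w) hw, Contour.winding, Contour.winding, Contour.reflect_integral]
    congr 1
    rw [neg_eq_iff_eq_neg, ← neg_one_mul, ← Contour.integral_const_mul]
    congr 1
    ext z
    rw [neg_one_mul, ← inv_neg]
    congr 1
    ring

theorem Contour.Encloses.re_ne_zero_of_mem {Γ : Contour} {S : Set ℂ} (h : Γ.Encloses S) {z : ℂ}
    (hz : z ∈ Γ.image) : z.re ≠ 0 := by
  obtain ⟨l, s, hs, rfl⟩ := mem_iUnion.1 hz
  exact h.re_ne_zero l s hs

theorem Contour.Encloses.ne_of_mem {Γ : Contour} {S : Set ℂ} (h : Γ.Encloses S) {z w : ℂ}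
    (hz : z ∈ Γ.image) (hw : w ∈ S) : z - w ≠ 0 := by
  obtain ⟨l, s, hs, rfl⟩ := mem_iUnion.1 hz
  exact fun h0 => h.notMem l s hs (sub_eq_zero.1 h0 ▸ hw)


/-! ### Left residue sums: differential equation and values at zero. -/

section

/-- The function `∏_{d ∈ X} (z - d)⁻¹` on the left half-plane, `0` on the right half-plane. -/
def leftProd (X : Multiset ℂ) (z : ℂ) : ℂ :=
  if 0 < z.re then 0 else (X.map fun d => (z - d)⁻¹).prod

/-- The sum of the residues of `e^{τz} ∏_{d ∈ X} (z - d)⁻¹` in the left half-plane, as a contour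
integral. -/
def Contour.leftResidue (Γ : Contour) (τ : ℝ) (X : Multiset ℂ) : ℂ :=
  (2 * Real.pi * Complex.I)⁻¹ * Γ.integral fun z => Complex.exp (z * τ) * leftProd X z

theorem eventually_re_pos_iff {z : ℂ} (hz : z.re ≠ 0) :
    ∀ᶠ w : ℂ in 𝓝 z, (0 < w.re ↔ 0 < z.re) := by
  rcases lt_or_gt_of_ne hz with h | h
  · filter_upwards [Complex.continuous_re.continuousAt.eventually_lt_const h] with w hw
    exact ⟨fun h' => absurd hw h'.not_gt, fun h' => absurd h h'.not_gt⟩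
  · filter_upwards [Complex.continuous_re.continuousAt.eventually_const_lt h] with w hw
    exact ⟨fun _ => h, fun _ => hw⟩

theorem hasDerivAt_ite_re {F G : ℂ → ℂ} {F' G' z : ℂ} (hz : z.re ≠ 0)
    (hF : 0 < z.re → HasDerivAt F F' z) (hG : z.re < 0 → HasDerivAt G G' z) :
    HasDerivAt (fun w => if 0 < w.re then F w else G w) (if 0 < z.re then F' else G') z := by
  rcases lt_or_gt_of_ne hz with h | h
  · rw [if_neg h.not_gt]
    refine (hG h).congr_of_eventuallyEq ?_
    filter_upwards [eventually_re_pos_iff hz] with w hw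
    rw [if_neg (mt hw.1 h.not_gt)]
  · rw [if_pos h]
    refine (hF h).congr_of_eventuallyEq ?_
    filter_upwards [eventually_re_pos_iff hz] with w hw
    rw [if_pos (hw.2 h)]

theorem continuousAt_ite_re {F G : ℂ → ℂ} {z : ℂ} (hz : z.re ≠ 0)
    (hF : 0 < z.re → ContinuousAt F z) (hG : z.re < 0 → ContinuousAt G z) :
    ContinuousAt (fun w => if 0 < w.re then F w else G w) z := by
  rcases lt_or_gt_of_ne hz with h | h
  · refine (hG h).congr ?_
    filter_upwards [eventually_re_pos_iff hz] with w hw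
    rw [if_neg (mt hw.1 h.not_gt)]
  · refine (hF h).congr ?_
    filter_upwards [eventually_re_pos_iff hz] with w hw
    rw [if_pos (hw.2 h)]

theorem continuousAt_prod_inv {X : Multiset ℂ} {z : ℂ} (h : ∀ d ∈ X, z - d ≠ 0) :
    ContinuousAt (fun z => (X.map fun d => (z - d)⁻¹).prod) z := by
  induction X using Multiset.induction with
  | empty => simpa using continuousAt_const
  | cons a X ih =>
    simp only [Multiset.map_cons, Multiset.prod_cons]
    have h1 : ContinuousAt (fun z => (z - a)⁻¹) z :=
      ContinuousAt.inv₀ (by fun_prop) (h a (by simp))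
    exact h1.fun_mul (ih fun d hd => h d (Multiset.mem_cons_of_mem hd))

theorem leftProd_cons (c : ℂ) (X : Multiset ℂ) (z : ℂ) :
    leftProd (c ::ₘ X) z = (z - c)⁻¹ * leftProd X z := by
  unfold leftProd
  split_ifs <;> simp

variable {Γ : Contour} {S : Set ℂ}

theorem Contour.Encloses.continuousOn_leftProd (h : Γ.Encloses S) {X : Multiset ℂ}
    (hX : ∀ d ∈ X, d ∈ S) : ContinuousOn (leftProd X) Γ.image := fun _ hz =>
  (continuousAt_ite_re (h.re_ne_zero_of_mem hz) (fun _ => continuousAt_const) fun _ =>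
    continuousAt_prod_inv fun d hd => h.ne_of_mem hz (hX d hd)).continuousWithinAt

theorem Contour.Encloses.continuousOn_exp_mul_leftProd (h : Γ.Encloses S) {X : Multiset ℂ}
    (hX : ∀ d ∈ X, d ∈ S) (τ : ℝ) :
    ContinuousOn (fun z => Complex.exp (z * τ) * leftProd X z) Γ.image :=
  (by fun_prop : Continuous fun z : ℂ => Complex.exp (z * τ)).continuousOn.mul
    (h.continuousOn_leftProd hX)

/-- Differentiating brings down a factor `z`, and `z (z - c)⁻¹ = c (z - c)⁻¹ + 1`. -/
theorem Contour.Encloses.hasDerivAt_leftResidue (h : Γ.Encloses S) {c : ℂ} {X : Multiset ℂ}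
    (hc : c ∈ S) (hX : ∀ d ∈ X, d ∈ S) (τ : ℝ) :
    HasDerivAt (fun τ => Γ.leftResidue τ (c ::ₘ X))
      (c * Γ.leftResidue τ (c ::ₘ X) + Γ.leftResidue τ X) τ := by
  have hcX : ∀ d ∈ c ::ₘ X, d ∈ S := by simpa [hc] using hX
  refine ((Γ.hasDerivAt_integral_exp (h.continuousOn_leftProd hcX) τ).const_mul
    (2 * Real.pi * Complex.I : ℂ)⁻¹).congr_deriv ?_
  have h1 : (Γ.integral fun z => z * (Complex.exp (z * τ) * leftProd (c ::ₘ X) z) -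
      c * (Complex.exp (z * τ) * leftProd (c ::ₘ X) z)) =
      Γ.integral fun z => Complex.exp (z * τ) * leftProd X z := by
    refine Γ.integral_congr fun z hz => ?_
    have := h.ne_of_mem hz hc
    simp only [leftProd_cons]
    field_simp
  rw [Γ.integral_sub (ContinuousOn.fun_mul (by fun_prop) (h.continuousOn_exp_mul_leftProd hcX τ))
    (ContinuousOn.fun_mul (by fun_prop) (h.continuousOn_exp_mul_leftProd hcX τ)),
    Γ.integral_const_mul] at h1
  rw [leftResidue, leftResidue, ← h1]
  ring

theorem Contour.Encloses.leftResidue_zero (h : Γ.Encloses S) (τ : ℝ) :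
    Γ.leftResidue τ 0 = 0 := by
  -- A primitive may be chosen separately in each half-plane, since the contour avoids the imaginary
  -- axis; `τ = 0` needs its own formula.
  rw [leftResidue, Γ.integral_eq_zero_of_hasDerivAt
    (F := fun w => if 0 < w.re then 0 else if τ = 0 then w else Complex.exp (w * τ) / τ)
    (h.continuousOn_exp_mul_leftProd (by simp) τ) fun z hz => ?_, mul_zero]
  have : Complex.exp (z * τ) * leftProd 0 z = if 0 < z.re then 0 else Complex.exp (z * τ) := by
    simp [leftProd]
  rw [this]
  refine hasDerivAt_ite_re (h.re_ne_zero_of_mem hz) (fun _ => hasDerivAt_const _ _) fun _ => ?_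
  by_cases hτ : τ = 0
  · simpa [hτ] using hasDerivAt_id' z
  · have hτ' : (τ : ℂ) ≠ 0 := by exact_mod_cast hτ
    simp only [hτ, if_false]
    have h1 := (((hasDerivAt_id z).mul_const (τ : ℂ)).cexp).div_const (τ : ℂ)
    simpa [hτ'] using h1

theorem Contour.Encloses.leftResidue_zero_singleton (h : Γ.Encloses S) {a : ℂ} (ha : a ∈ S)
    (hre : a.re < 0) : Γ.leftResidue 0 {a} = 1 := by
  rw [← h.winding_eq_one a ha, leftResidue, winding]
  congr 1
  have hc : ContinuousOn (fun z => (z - a)⁻¹) Γ.image :=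
    ContinuousOn.inv₀ (by fun_prop) fun z hz => h.ne_of_mem hz ha
  have hl : ContinuousOn (leftProd {a}) Γ.image := h.continuousOn_leftProd (by simpa using ha)
  -- The difference lives in the right half-plane, where `re (z - a) > 0`, so the principal
  -- logarithm of `z - a` is a primitive.
  have h1 : Γ.integral (fun z => (z - a)⁻¹ - leftProd {a} z) = 0 := by
    refine Γ.integral_eq_zero_of_hasDerivAt
      (F := fun w => if 0 < w.re then Complex.log (w - a) else 0) (hc.sub hl) fun z hz => ?_
    have : (z - a)⁻¹ - leftProd {a} z = if 0 < z.re then (z - a)⁻¹ else 0 := by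
      unfold leftProd
      split_ifs <;> simp
    rw [this]
    refine hasDerivAt_ite_re (h.re_ne_zero_of_mem hz) (fun hz => ?_) fun _ => hasDerivAt_const _ _
    have h2 := ((hasDerivAt_id z).sub_const a).clog (Or.inl (by simp; linarith))
    simpa using h2
  rw [Γ.integral_sub hc hl, sub_eq_zero] at h1
  simpa using h1.symm

/-- Partial fractions: two distinct points are split, which lowers the number of factors. A product
with a single repeated point is a power of exponent at least two, so it has a primitive. -/
theorem Contour.Encloses.leftResidue_zero_cons_cons (h : Γ.Encloses S) (X : Multiset ℂ) :
    ∀ a b : ℂ, a ∈ S → a.re < 0 → b ∈ S → b.re < 0 → (∀ d ∈ X, d ∈ S ∧ d.re < 0) →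
      Γ.leftResidue 0 (a ::ₘ b ::ₘ X) = 0 := by
  -- two distinct points are separated by the resolvent identity
  have split : ∀ (a b : ℂ) (Y : Multiset ℂ), a ≠ b → a ∈ S → b ∈ S → (∀ d ∈ Y, d ∈ S) →
      Γ.leftResidue 0 (a ::ₘ b ::ₘ Y) =
        (a - b)⁻¹ * (Γ.leftResidue 0 (a ::ₘ Y) - Γ.leftResidue 0 (b ::ₘ Y)) := by
    intro a b Y hab ha hb hY
    have hY' : ∀ c ∈ S, ∀ d ∈ c ::ₘ Y, d ∈ S := fun c hc => by simpa [hc] using hY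
    rw [leftResidue, leftResidue, leftResidue, ← mul_sub, ← Γ.integral_sub
      (h.continuousOn_exp_mul_leftProd (hY' a ha) 0) (h.continuousOn_exp_mul_leftProd (hY' b hb) 0),
      mul_left_comm]
    congr 1
    rw [← Γ.integral_const_mul]
    refine Γ.integral_congr fun z hz => ?_
    have h1 := h.ne_of_mem hz ha
    have h2 := h.ne_of_mem hz hb
    have h3 := sub_ne_zero.2 hab
    simp only [leftProd_cons]
    field_simp
    ring
  induction hn : X.card using Nat.strong_induction_on generalizing X with
  | _ n ih =>
  intro a b ha ha' hb hb' hX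
  by_cases hall : b = a ∧ ∀ d ∈ X, d = a
  · obtain ⟨rfl, hall⟩ := hall
    rw [Multiset.eq_replicate_of_mem hall, leftResidue, Γ.integral_eq_zero_of_hasDerivAt
      (F := fun w => if 0 < w.re then 0 else -((n + 1 : ℂ)⁻¹ * ((w - b)⁻¹) ^ (n + 1)))
      (h.continuousOn_exp_mul_leftProd
        (by
          intro d hd
          simp only [Multiset.mem_cons, Multiset.mem_replicate] at hd
          rcases hd with rfl | rfl | hd
          · exact hb
          · exact hb
          · exact hd.2 ▸ hb) 0) fun z hz => ?_, mul_zero]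
    have hzb := h.ne_of_mem hz hb
    have : Complex.exp (z * (0 : ℝ)) * leftProd (b ::ₘ b ::ₘ Multiset.replicate X.card b) z =
        if 0 < z.re then 0 else ((z - b)⁻¹) ^ (n + 2) := by
      unfold leftProd
      split_ifs
      · simp
      · simp [hn, pow_succ']
    rw [this]
    refine hasDerivAt_ite_re (h.re_ne_zero_of_mem hz) (fun _ => hasDerivAt_const _ _) fun _ => ?_
    have hn0 : (n + 1 : ℂ) ≠ 0 := by exact_mod_cast n.succ_ne_zero
    refine ((((((hasDerivAt_id' z).sub_const b).fun_inv hzb).fun_pow (n + 1)).const_mul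
      (n + 1 : ℂ)⁻¹)).fun_neg.congr_deriv ?_
    push_cast [Nat.add_sub_cancel]
    have hinv := mul_inv_cancel₀ hzb
    field_simp
    rw [one_div]
    generalize (z - b)⁻¹ = y at hinv ⊢
    linear_combination (-(1 + (z - b) * y) * y ^ n) * hinv
  -- Some point differs from `a`; it is moved next to `a` so that `split` applies.
  · have hex : ∃ c X', c ≠ a ∧ b ::ₘ X = c ::ₘ X' := by
      by_cases hba : b = a
      · have : ∃ d ∈ X, d ≠ a := by
          by_contra hcon
          push Not at hcon
          exact hall ⟨hba, hcon⟩
        obtain ⟨d, hd, hda⟩ := this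
        obtain ⟨X', rfl⟩ := Multiset.exists_cons_of_mem hd
        exact ⟨d, b ::ₘ X', hda, Multiset.cons_swap _ _ _⟩
      · exact ⟨b, X, hba, rfl⟩
    obtain ⟨c, X', hca, heq⟩ := hex
    have hmem : ∀ d ∈ c ::ₘ X', d ∈ S ∧ d.re < 0 := by
      rw [← heq]
      simpa [hb, hb'] using hX
    have hc := hmem c (by simp)
    have hX' : ∀ d ∈ X', d ∈ S ∧ d.re < 0 := fun d hd => hmem d (Multiset.mem_cons_of_mem hd)
    have hcard : X'.card = X.card := by simpa using (congrArg Multiset.card heq).symm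
    rw [heq, split a c X' hca.symm ha hc.1 fun d hd => (hX' d hd).1]
    -- With two points in all, both split terms equal `1` and cancel; otherwise each still has two
    -- points and vanishes by induction.
    rcases X'.empty_or_exists_mem with rfl | ⟨e, he⟩
    · rw [show (a ::ₘ (0 : Multiset ℂ)) = {a} from rfl, show (c ::ₘ (0 : Multiset ℂ)) = {c} from rfl,
        h.leftResidue_zero_singleton ha ha', h.leftResidue_zero_singleton hc.1 hc.2]
      simp
    · obtain ⟨X'', rfl⟩ := Multiset.exists_cons_of_mem he
      have hlt : X''.card < n := by
        rw [← hn, ← hcard]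
        simp
      have he' := hX' e (by simp)
      have hX'' : ∀ d ∈ X'', d ∈ S ∧ d.re < 0 := fun d hd => hX' d (Multiset.mem_cons_of_mem hd)
      rw [ih _ hlt X'' rfl a e ha ha' he'.1 he'.2 hX'',
        ih _ hlt X'' rfl c e hc.1 hc.2 he'.1 he'.2 hX'']
      simp

/-! ### Bounds by variation of constants. -/

theorem hasDerivAt_exp_mul_of_ode {f : ℝ → ℂ} {c r : ℂ} {s : ℝ} (τ : ℝ)
    (hf : HasDerivAt f (c * f s + r) s) :
    HasDerivAt (fun s : ℝ => Complex.exp (c * (τ - s)) * f s)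
      (Complex.exp (c * (τ - s)) * r) s := by
  have h1 : HasDerivAt (fun s : ℝ => c * ((τ : ℂ) - s)) (-c) s := by
    simpa using ((Complex.ofRealCLM.hasDerivAt (x := s)).const_sub (τ : ℂ)).const_mul c
  refine (h1.cexp.fun_mul hf).congr_deriv ?_
  ring

theorem norm_exp_mul_sub (c : ℂ) (τ s : ℝ) :
    ‖Complex.exp (c * (τ - s))‖ = Real.exp (c.re * (τ - s)) := by
  rw [← Complex.ofReal_sub, Complex.norm_exp, Complex.re_mul_ofReal]

theorem hasDerivAt_pow_div_factorial (m : ℕ) (s : ℝ) :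
    HasDerivAt (fun s : ℝ => s ^ (m + 1) / ((m + 1).factorial : ℝ)) (s ^ m / (m.factorial : ℝ))
      s := by
  refine ((hasDerivAt_pow (m + 1) s).div_const ((m + 1).factorial : ℝ)).congr_deriv ?_
  rw [Nat.factorial_succ]
  push_cast
  have : (m.factorial : ℝ) ≠ 0 := by exact_mod_cast m.factorial_ne_zero
  have : (m + 1 : ℝ) ≠ 0 := by positivity
  field_simp

/-- Forward integration from `0`: the propagator contributes at most `e^{-α(τ-s)}` and the inductive
bound `e^{-αs} s^m / m!`. The exponentials combine to the constant `e^{-ατ}`, and the power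
integrates to the next one. -/
theorem Contour.Encloses.norm_leftResidue_le_of_left (h : Γ.Encloses S) {α : ℝ} (hα : 0 < α)
    (X : Multiset ℂ) (hX : ∀ d ∈ X, d ∈ S ∧ d.re ≤ -α) :
    ∀ a ∈ S, a.re ≤ -α → ∀ τ : ℝ, 0 ≤ τ →
      ‖Γ.leftResidue τ (a ::ₘ X)‖ ≤
        Real.exp (-α * τ) * (τ ^ X.card / (X.card.factorial : ℝ)) := by
  induction X using Multiset.induction with
  | empty =>
    intro a ha ha' τ hτ
    have hd : ∀ s : ℝ, HasDerivAt (fun s : ℝ => Complex.exp (a * (τ - s)) * Γ.leftResidue s (a ::ₘ 0))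
        0 s := by
      intro s
      have h1 := hasDerivAt_exp_mul_of_ode τ
        (h.hasDerivAt_leftResidue (X := 0) ha (by simp) s)
      rwa [h.leftResidue_zero, mul_zero] at h1
    have h2 := is_const_of_deriv_eq_zero (fun s => (hd s).differentiableAt)
      (fun s => (hd s).deriv) τ 0
    have h3 : Γ.leftResidue 0 (a ::ₘ 0) = 1 :=
      h.leftResidue_zero_singleton ha (by linarith)
    simp only [sub_self, mul_zero, Complex.exp_zero, one_mul, h3, mul_one] at h2
    rw [h2, norm_exp_mul_sub]
    simp only [Multiset.card_zero, pow_zero, Nat.factorial_zero, Nat.cast_one, div_one, mul_one,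
      sub_zero]
    exact Real.exp_le_exp.2 (mul_le_mul_of_nonneg_right ha' hτ)
  | cons b X ih =>
    intro a ha ha' τ hτ
    have hb := hX b (by simp)
    have hX' : ∀ d ∈ X, d ∈ S ∧ d.re ≤ -α := fun d hd => hX d (Multiset.mem_cons_of_mem hd)
    have hd : ∀ s : ℝ, HasDerivAt
        (fun s : ℝ => Complex.exp (a * (τ - s)) * Γ.leftResidue s (a ::ₘ b ::ₘ X))
        (Complex.exp (a * (τ - s)) * Γ.leftResidue s (b ::ₘ X)) s := fun s =>
      hasDerivAt_exp_mul_of_ode τ (h.hasDerivAt_leftResidue ha (fun d hd => (hX d hd).1) s)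
    have h0 : Γ.leftResidue 0 (a ::ₘ b ::ₘ X) = 0 :=
      h.leftResidue_zero_cons_cons X a b ha (by linarith) hb.1 (by linarith) fun d hd =>
        ⟨(hX' d hd).1, by linarith [(hX' d hd).2]⟩
    have key := image_norm_le_of_norm_deriv_right_le_deriv_boundary (a := 0) (b := τ)
      (B := fun s => Real.exp (-α * τ) * (s ^ (X.card + 1) / ((X.card + 1).factorial : ℝ)))
      (B' := fun s => Real.exp (-α * τ) * (s ^ X.card / (X.card.factorial : ℝ)))
      (fun s _ => (hd s).continuousAt.continuousWithinAt) (fun s _ => (hd s).hasDerivWithinAt)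
      (by simp [h0])
      (fun s => (hasDerivAt_pow_div_factorial X.card s).const_mul _)
      (fun s hs => by
        rw [norm_mul, norm_exp_mul_sub]
        have h1 := ih hX' b hb.1 hb.2 s hs.1
        have h2 : Real.exp (a.re * (τ - s)) ≤ Real.exp (-α * (τ - s)) :=
          Real.exp_le_exp.2 (mul_le_mul_of_nonneg_right ha' (by linarith [hs.2]))
        calc _ ≤ Real.exp (-α * (τ - s)) *
              (Real.exp (-α * s) * (s ^ X.card / (X.card.factorial : ℝ))) := by gcongr
          _ = _ := by
            rw [← mul_assoc, ← Real.exp_add]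
            ring_nf)
      (right_mem_Icc.2 hτ)
    simpa using key

/-- Backward integration from infinity, where the propagated residue sum `H` vanishes. The
inequality `hUV` says exactly that the barrier `W` decreases at least as fast as `H` can vary. -/
theorem Contour.Encloses.norm_leftResidue_cons_le_of_right (h : Γ.Encloses S) {α β : ℝ}
    {b : ℂ} {X : Multiset ℂ} (hb : b ∈ S) (hβ : 0 < β) (hb' : β ≤ b.re)
    (hX : ∀ d ∈ X, d ∈ S) {U U' V : ℝ → ℝ}
    (hV : ∀ τ, 0 < τ → ‖Γ.leftResidue τ X‖ ≤ Real.exp (-α * τ) * V τ)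
    (hU : ∀ τ, HasDerivAt U (U' τ) τ) (hU0 : ∀ τ, 0 < τ → 0 ≤ U τ)
    (hUV : ∀ τ, 0 < τ → U' τ + V τ ≤ (α + β) * U τ) {τ : ℝ} (hτ : 0 < τ) :
    ‖Γ.leftResidue τ (b ::ₘ X)‖ ≤ Real.exp (-α * τ) * U τ := by
  have hbX : ∀ d ∈ b ::ₘ X, d ∈ S := by simpa [hb] using hX
  set H : ℝ → ℂ := fun s => Complex.exp (b * (τ - s)) * Γ.leftResidue s (b ::ₘ X) with hH
  have hd : ∀ s : ℝ, HasDerivAt H (Complex.exp (b * (τ - s)) * Γ.leftResidue s X) s := fun s =>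
    hasDerivAt_exp_mul_of_ode τ (h.hasDerivAt_leftResidue hb hX s)
  set W : ℝ → ℝ := fun s => Real.exp (β * (τ - s) - α * s) * U s with hW
  have hWd : ∀ s, HasDerivAt W
      (Real.exp (β * (τ - s) - α * s) * (U' s - (α + β) * U s)) s := by
    intro s
    have h1 : HasDerivAt (fun s => β * (τ - s) - α * s) (-(α + β)) s := by
      refine ((((hasDerivAt_id' s).const_sub τ).const_mul β).fun_sub
        ((hasDerivAt_id' s).const_mul α)).congr_deriv ?_
      ring
    refine (h1.exp.fun_mul (hU s)).congr_deriv ?_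
    ring
  have hWτ : W τ = Real.exp (-α * τ) * U τ := by simp [hW]
  have key : ∀ σ, τ ≤ σ → ‖H σ - H τ‖ ≤ W τ := by
    intro σ hσ
    have := image_norm_le_of_norm_deriv_right_le_deriv_boundary (a := τ) (b := σ)
      (f := fun s => H s - H τ) (B := fun s => W τ - W s)
      (fun s _ => ((hd s).sub_const (H τ)).continuousAt.continuousWithinAt)
      (fun s _ => ((hd s).sub_const (H τ)).hasDerivWithinAt)
      (by simp) (fun s => (hWd s).const_sub (W τ))
      (fun s hs => by
        have hs0 : 0 < s := hτ.trans_le hs.1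
        have h1 : Real.exp (b.re * (τ - s)) ≤ Real.exp (β * (τ - s)) :=
          Real.exp_le_exp.2 (mul_le_mul_of_nonpos_right hb' (by linarith [hs.1]))
        rw [norm_mul, norm_exp_mul_sub]
        calc _ ≤ Real.exp (β * (τ - s)) * (Real.exp (-α * s) * V s) := by
              gcongr
              exact hV s hs0
          _ = Real.exp (β * (τ - s) - α * s) * V s := by
              rw [← mul_assoc, ← Real.exp_add]
              ring_nf
          _ ≤ Real.exp (β * (τ - s) - α * s) * (-(U' s - (α + β) * U s)) := by
              gcongr
              linarith [hUV s hs0]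
          _ = _ := by ring)
      (right_mem_Icc.2 hσ)
    have hWσ : 0 ≤ W σ := mul_nonneg (Real.exp_pos _).le (hU0 σ (hτ.trans_le hσ))
    linarith
  obtain ⟨C, hC⟩ := Γ.isCompact_image.exists_bound_of_continuousOn (h.continuousOn_leftProd hbX)
  -- Uniform in `s ≥ 0`: the integrand is zero on the right, and `|e^{zs}| ≤ 1` on the left.
  have hbound : ∀ s, 0 ≤ s → ‖Γ.leftResidue s (b ::ₘ X)‖ ≤
      ‖(2 * Real.pi * Complex.I : ℂ)⁻¹‖ * (C * Γ.length) := by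
    intro s hs
    rw [leftResidue, norm_mul]
    refine mul_le_mul_of_nonneg_left (Γ.norm_integral_le fun z hz => ?_) (norm_nonneg _)
    by_cases hre : 0 < z.re
    · have := hC z hz
      simp only [leftProd, if_pos hre, mul_zero] at this ⊢
      exact this
    · rw [norm_mul, Complex.norm_exp, Complex.re_mul_ofReal]
      refine (mul_le_of_le_one_left (norm_nonneg _) ?_).trans (hC z hz)
      exact Real.exp_le_one_iff.2 (mul_nonpos_of_nonpos_of_nonneg (not_lt.1 hre) hs)
  have hlim : Tendsto H atTop (𝓝 0) := by
    have h1 : Tendsto (fun s : ℝ => b.re * (τ - s)) atTop atBot :=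
      Tendsto.const_mul_atBot (hβ.trans_le hb')
        (tendsto_atBot_add_const_left _ τ tendsto_neg_atTop_atBot)
    have h2 := (Real.tendsto_exp_atBot.comp h1).mul_const
      (‖(2 * Real.pi * Complex.I : ℂ)⁻¹‖ * (C * Γ.length))
    rw [zero_mul] at h2
    refine squeeze_zero_norm' ?_ h2
    filter_upwards [eventually_ge_atTop 0] with s hs
    rw [hH]
    simp only [norm_mul, norm_exp_mul_sub, Function.comp_apply]
    have := hbound s hs
    gcongr
  -- Letting `σ → ∞` in `key` removes `H σ`, and `H τ` is the residue sum at `τ` itself.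
  have hfin := le_of_tendsto (hlim.sub_const (H τ)).norm
    ((eventually_ge_atTop τ).mono key)
  rw [hWτ, zero_sub, norm_neg] at hfin
  simpa [hH] using hfin

/-! ### The majorizing polynomials and the uniform residue bound. -/

/-- The polynomial `∑_j (k + j choose j) τ^{k-j} / ((k - j)! γ^j)`. -/
def besselPoly (γ : ℝ) (k : ℕ) (τ : ℝ) : ℝ :=
  ∑ j ∈ Finset.range (k + 1),
    ((k + j).choose j : ℝ) * (τ ^ (k - j) / ((k - j).factorial : ℝ)) / γ ^ j

/-- The derivative of `besselPoly γ k`. -/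
def besselPolyDeriv (γ : ℝ) (k : ℕ) (τ : ℝ) : ℝ :=
  ∑ j ∈ Finset.range k,
    ((k + j).choose j : ℝ) * (τ ^ (k - 1 - j) / ((k - 1 - j).factorial : ℝ)) / γ ^ j

theorem hasDerivAt_besselPoly (γ : ℝ) (k : ℕ) (τ : ℝ) :
    HasDerivAt (besselPoly γ k) (besselPolyDeriv γ k τ) τ := by
  have h1 : besselPoly γ k = fun τ => (∑ j ∈ Finset.range k,
      ((k + j).choose j : ℝ) * (τ ^ (k - j) / ((k - j).factorial : ℝ)) / γ ^ j) +
      ((k + k).choose k : ℝ) / γ ^ k := by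
    ext τ
    rw [besselPoly, Finset.sum_range_succ]
    simp
  rw [h1]
  refine HasDerivAt.add_const _ (HasDerivAt.fun_sum fun j hj => ?_)
  have hjk := Finset.mem_range.1 hj
  obtain ⟨m, rfl⟩ : ∃ m, k = j + m + 1 := ⟨k - j - 1, by omega⟩
  have e1 : j + m + 1 - j = m + 1 := by omega
  have e2 : j + m + 1 - 1 - j = m := by omega
  rw [e1, e2]
  exact ((hasDerivAt_pow_div_factorial m τ).const_mul _).div_const _

theorem besselPoly_nonneg {γ τ : ℝ} (hγ : 0 < γ) (hτ : 0 < τ) (k : ℕ) :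
    0 ≤ besselPoly γ k τ := Finset.sum_nonneg fun j _ => by positivity

theorem pow_div_factorial_le_besselPoly {γ τ : ℝ} (hγ : 0 < γ) (hτ : 0 < τ) (k : ℕ) :
    τ ^ k / (k.factorial : ℝ) ≤ besselPoly γ k τ := by
  have := Finset.single_le_sum (f := fun j => ((k + j).choose j : ℝ) *
    (τ ^ (k - j) / ((k - j).factorial : ℝ)) / γ ^ j) (s := Finset.range (k + 1))
    (fun j _ => by positivity) (Finset.mem_range.2 k.succ_pos)
  simpa [besselPoly] using this

/-- Coefficientwise comparison after shifting `j` by one on the right; the unmatched `j = 0` term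
there is nonnegative. The binomial inequality is Pascal's rule applied twice, with one term
discarded. -/
theorem besselPolyDeriv_add_le {γ τ : ℝ} (hγ : 0 < γ) (hτ : 0 < τ) (k : ℕ) :
    besselPolyDeriv γ (k + 1) τ + besselPoly γ k τ ≤ γ * besselPoly γ (k + 1) τ := by
  rw [besselPolyDeriv, besselPoly, ← Finset.sum_add_distrib, besselPoly,
    Finset.sum_range_succ' _ (k + 1), mul_add, Finset.mul_sum]
  refine le_add_of_le_of_nonneg (Finset.sum_le_sum fun j _ => ?_) (by positivity)
  have e1 : k + 1 - (j + 1) = k - j := by omega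
  have e2 : k + 1 - 1 - j = k - j := by omega
  rw [e1, e2]
  have h1 : (k + 1 + j).choose j + (k + j).choose j ≤ (k + 1 + (j + 1)).choose (j + 1) := by
    have h2 := Nat.choose_succ_succ (k + 1 + j) j
    have h3 := Nat.choose_succ_succ (k + j) j
    have e3 : k + 1 + j = k + j + 1 := by omega
    rw [show k + 1 + (j + 1) = k + 1 + j + 1 by omega]
    simp only [Nat.succ_eq_add_one] at h2 h3
    rw [e3] at h2 ⊢
    omega
  have h2 : ((k + 1 + j).choose j : ℝ) + ((k + j).choose j : ℝ) ≤
      ((k + 1 + (j + 1)).choose (j + 1) : ℝ) := by exact_mod_cast h1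
  calc _ = (((k + 1 + j).choose j : ℝ) + ((k + j).choose j : ℝ)) *
        (τ ^ (k - j) / ((k - j).factorial : ℝ)) / γ ^ j := by ring
    _ ≤ ((k + 1 + (j + 1)).choose (j + 1) : ℝ) *
        (τ ^ (k - j) / ((k - j).factorial : ℝ)) / γ ^ j := by gcongr
    _ = _ := by
      rw [pow_succ]
      field_simp

/-- The functions `besselPoly γ (m - 1)`, with the value `0` for `m = 0`. -/
def residueBound (γ : ℝ) : ℕ → ℝ → ℝ
  | 0, _ => 0
  | k + 1, τ => besselPoly γ k τ

theorem Contour.Encloses.norm_leftResidue_le (h : Γ.Encloses S) {α β : ℝ} (hα : 0 < α)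
    (hβ : 0 < β) (hS : ∀ d ∈ S, d.re ≤ -α ∨ β ≤ d.re) {X : Multiset ℂ} (hX : ∀ d ∈ X, d ∈ S)
    {τ : ℝ} (hτ : 0 < τ) :
    ‖Γ.leftResidue τ X‖ ≤ Real.exp (-α * τ) * residueBound (α + β) X.card τ := by
  have hγ : 0 < α + β := by linarith
  -- The order of the points is free, so all left points are treated first and the right ones are
  -- added one at a time.
  have main : ∀ L R : Multiset ℂ, (∀ d ∈ L, d ∈ S ∧ d.re ≤ -α) → (∀ d ∈ R, d ∈ S ∧ β ≤ d.re) →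
      ∀ τ, 0 < τ → ‖Γ.leftResidue τ (R + L)‖ ≤
        Real.exp (-α * τ) * residueBound (α + β) (R + L).card τ := by
    intro L R hL
    induction R using Multiset.induction with
    | empty =>
      intro _ τ hτ
      rw [zero_add]
      rcases L.empty_or_exists_mem with rfl | ⟨a, ha⟩
      · simp [h.leftResidue_zero, residueBound]
      · obtain ⟨L, rfl⟩ := Multiset.exists_cons_of_mem ha
        have ha' := hL a ha
        refine (h.norm_leftResidue_le_of_left hα L
          (fun d hd => hL d (Multiset.mem_cons_of_mem hd)) a ha'.1 ha'.2 τ hτ.le).trans ?_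
        rw [Multiset.card_cons, residueBound]
        gcongr
        exact pow_div_factorial_le_besselPoly hγ hτ _
    | cons b R ih =>
      intro hR τ hτ
      have hb := hR b (by simp)
      have hR' : ∀ d ∈ R, d ∈ S ∧ β ≤ d.re := fun d hd => hR d (Multiset.mem_cons_of_mem hd)
      rw [Multiset.cons_add, Multiset.card_cons, residueBound]
      refine h.norm_leftResidue_cons_le_of_right hb.1 hβ hb.2 (fun d hd => ?_) (ih hR')
        (hasDerivAt_besselPoly _ _) (fun s hs => besselPoly_nonneg hγ hs _) (fun s hs => ?_) hτ
      · rcases Multiset.mem_add.1 hd with hd | hd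
        · exact (hR' d hd).1
        · exact (hL d hd).1
      · cases (R + L).card with
        | zero => simpa [residueBound, besselPolyDeriv] using
            mul_nonneg hγ.le (besselPoly_nonneg hγ hs 0)
        | succ k => exact besselPolyDeriv_add_le hγ hs k
  have hsplit := Multiset.filter_add_not (fun d : ℂ => β ≤ d.re) X
  rw [← hsplit]
  refine main _ _ (fun d hd => ?_) (fun d hd => ?_) τ hτ
  · rw [Multiset.mem_filter] at hd
    exact ⟨hX d hd.1, (hS d (hX d hd.1)).resolve_right hd.2⟩
  · rw [Multiset.mem_filter] at hd
    exact ⟨hX d hd.1, hd.2⟩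

end

/-! ### Closed form of the Bessel function of half-integer order. -/

theorem cosh_odd_mul (v : ℝ) (k : ℕ) :
    Real.cosh ((2 * k + 1) * v) = Real.cosh v *
      ∑ j ∈ Finset.range (k + 1), ((k + j).choose (2 * j) : ℝ) * (4 * Real.sinh v ^ 2) ^ j := by
  set y := 4 * Real.sinh v ^ 2 with hy
  set P : ℕ → ℝ := fun k => ∑ j ∈ Finset.range (k + 1), ((k + j).choose (2 * j) : ℝ) * y ^ j with hP
  have hext : ∀ k m, k + 1 ≤ m →
      P k = ∑ j ∈ Finset.range m, ((k + j).choose (2 * j) : ℝ) * y ^ j := by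
    intro k m hm
    simp only [hP]
    refine Finset.sum_subset (Finset.range_mono hm) fun j _ hj => ?_
    rw [Finset.mem_range, not_lt] at hj
    rw [Nat.choose_eq_zero_of_lt (by omega)]
    simp
  -- The same recurrence as for `cosh ((2k+1)v)`, whose coefficient is `2 cosh (2v) = 2 + y`.
  have hrec : ∀ k, P (k + 2) + P k = (2 + y) * P (k + 1) := by
    intro k
    have hA : P (k + 1) = ∑ j ∈ Finset.range (k + 2),
        ((k + 1 + (j + 1)).choose (2 * (j + 1)) : ℝ) * y ^ (j + 1) + 1 := by
      rw [hext (k + 1) (k + 3) (by omega), Finset.sum_range_succ']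
      simp
    have hB : P k = ∑ j ∈ Finset.range (k + 2),
        ((k + (j + 1)).choose (2 * (j + 1)) : ℝ) * y ^ (j + 1) + 1 := by
      rw [hext k (k + 3) (by omega), Finset.sum_range_succ']
      simp
    have hC : P (k + 2) = ∑ j ∈ Finset.range (k + 2),
        ((k + 2 + (j + 1)).choose (2 * (j + 1)) : ℝ) * y ^ (j + 1) + 1 := by
      rw [hext (k + 2) (k + 3) le_rfl, Finset.sum_range_succ']
      simp
    have hD : y * P (k + 1) = ∑ j ∈ Finset.range (k + 2),
        ((k + 1 + j).choose (2 * j) : ℝ) * y ^ (j + 1) := by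
      rw [hext (k + 1) (k + 2) le_rfl, Finset.mul_sum]
      exact Finset.sum_congr rfl fun j _ => by ring
    have hsum : ∑ j ∈ Finset.range (k + 2),
          ((k + 2 + (j + 1)).choose (2 * (j + 1)) : ℝ) * y ^ (j + 1) +
        ∑ j ∈ Finset.range (k + 2), ((k + (j + 1)).choose (2 * (j + 1)) : ℝ) * y ^ (j + 1) =
        2 * ∑ j ∈ Finset.range (k + 2),
          ((k + 1 + (j + 1)).choose (2 * (j + 1)) : ℝ) * y ^ (j + 1) +
        ∑ j ∈ Finset.range (k + 2), ((k + 1 + j).choose (2 * j) : ℝ) * y ^ (j + 1) := by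
      rw [Finset.mul_sum, ← Finset.sum_add_distrib, ← Finset.sum_add_distrib]
      refine Finset.sum_congr rfl fun j _ => ?_
      have h1 : (k + 2 + (j + 1)).choose (2 * (j + 1)) + (k + (j + 1)).choose (2 * (j + 1)) =
          2 * (k + 1 + (j + 1)).choose (2 * (j + 1)) + (k + 1 + j).choose (2 * j) := by
        have e1 : k + 2 + (j + 1) = k + j + 1 + 1 + 1 := by omega
        have e2 : k + (j + 1) = k + j + 1 := by omega
        have e3 : k + 1 + (j + 1) = k + j + 1 + 1 := by omega
        have e4 : k + 1 + j = k + j + 1 := by omega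
        have e5 : 2 * (j + 1) = 2 * j + 1 + 1 := by omega
        rw [e1, e2, e3, e4, e5]
        simp only [Nat.choose_succ_succ' (k + j + 1 + 1), Nat.choose_succ_succ' (k + j + 1)]
        omega
      have h2 : ((k + 2 + (j + 1)).choose (2 * (j + 1)) : ℝ) +
          ((k + (j + 1)).choose (2 * (j + 1)) : ℝ) =
          2 * ((k + 1 + (j + 1)).choose (2 * (j + 1)) : ℝ) + ((k + 1 + j).choose (2 * j) : ℝ) := by
        exact_mod_cast h1
      rw [← add_mul, h2]
      ring
    linear_combination hC + hB - 2 * hA - hD + hsum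
  have hcosh2 : 2 * Real.cosh (2 * v) = 2 + y := by
    rw [hy, Real.cosh_two_mul, Real.cosh_sq]
    ring
  have hmain : ∀ k : ℕ, Real.cosh ((2 * k + 1) * v) = Real.cosh v * P k ∧
      Real.cosh ((2 * (k + 1 : ℕ) + 1) * v) = Real.cosh v * P (k + 1) := by
    intro k
    induction k with
    | zero =>
      constructor
      · simp [P]
      · have h3 : Real.cosh ((2 * (0 + 1 : ℕ) + 1) * v) = Real.cosh (3 * v) := by
          norm_num
        rw [h3, Real.cosh_three_mul]
        simp only [P, Finset.sum_range_succ, Finset.sum_range_zero, hy]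
        norm_num
        have := Real.cosh_sq v
        linear_combination (4 * Real.cosh v) * this
    | succ k ih =>
      refine ⟨ih.2, ?_⟩
      have e1 : (2 * ((k + 1 + 1 : ℕ) : ℝ) + 1) * v =
          (2 * ((k + 1 : ℕ) : ℝ) + 1) * v + 2 * v := by push_cast; ring
      have e2 : (2 * (k : ℝ) + 1) * v = (2 * ((k + 1 : ℕ) : ℝ) + 1) * v - 2 * v := by
        push_cast; ring
      have h1 := ih.1
      rw [e2, Real.cosh_sub] at h1
      rw [e1, Real.cosh_add]
      have h2 := hrec k
      have h3 := ih.2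
      linear_combination (2 * Real.cosh (2 * v)) * h3 - h1 +
        Real.cosh v * P (k + 1) * hcosh2 - Real.cosh v * h2
  exact (hmain k).1

theorem gamma_nat_add_half (j : ℕ) :
    Real.Gamma (j + 1 / 2) = √Real.pi * ((2 * j).factorial : ℝ) / (4 ^ j * (j.factorial : ℝ)) := by
  induction j with
  | zero => simpa using Real.Gamma_one_half_eq
  | succ j ih =>
    have h1 : ((j + 1 : ℕ) : ℝ) + 1 / 2 = (j + 1 / 2 : ℝ) + 1 := by push_cast; ring
    rw [h1, Real.Gamma_add_one (by positivity), ih, show 2 * (j + 1) = 2 * j + 1 + 1 by ring,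
      Nat.factorial_succ, Nat.factorial_succ, Nat.factorial_succ]
    push_cast
    field_simp
    ring

theorem integral_even_pow_mul_gaussian {b : ℝ} (hb : 0 < b) (j : ℕ) :
    ∫ s in Ioi (0 : ℝ), (4 * s ^ 2) ^ j * Real.exp (-b * s ^ 2) =
      √Real.pi * ((2 * j).factorial : ℝ) / (2 * (j.factorial : ℝ) * b ^ j * √b) := by
  have h1 := integral_rpow_mul_exp_neg_mul_rpow (p := 2) (q := 2 * j) (b := b) two_pos
    (by have : (0 : ℝ) ≤ j := j.cast_nonneg; linarith) hb
  have h2 : ∫ s in Ioi (0 : ℝ), (4 * s ^ 2) ^ j * Real.exp (-b * s ^ 2) =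
      4 ^ j * ∫ s in Ioi (0 : ℝ), s ^ (2 * j : ℝ) * Real.exp (-b * s ^ (2 : ℝ)) := by
    rw [← integral_const_mul]
    refine setIntegral_congr_fun measurableSet_Ioi fun s hs => ?_
    have e1 : s ^ (2 * j : ℝ) = s ^ (2 * j) := by
      rw [← Real.rpow_natCast]
      push_cast
      rfl
    simp only [e1, Real.rpow_two, mul_pow, pow_mul]
    ring
  have e2 : (2 * (j : ℝ) + 1) / 2 = j + 1 / 2 := by ring
  have e3 : b ^ (-(2 * (j : ℝ) + 1) / 2) = (b ^ j * √b)⁻¹ := by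
    rw [Real.sqrt_eq_rpow, ← Real.rpow_natCast, ← Real.rpow_add hb, ← Real.rpow_neg hb.le]
    congr 1
    ring
  rw [h2, h1, e2, e3, gamma_nat_add_half]
  field_simp

theorem integrableOn_even_pow_mul_gaussian {b : ℝ} (hb : 0 < b) (j : ℕ) :
    IntegrableOn (fun s : ℝ => (4 * s ^ 2) ^ j * Real.exp (-b * s ^ 2)) (Ioi 0) := by
  -- The integral of a non-integrable function is zero by convention, so a nonzero value proves
  -- integrability.
  refine Integrable.of_integral_ne_zero ?_
  rw [integral_even_pow_mul_gaussian hb]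
  have := Real.pi_pos
  positivity

theorem integral_comp_sinh_half (f : ℝ → ℝ) :
    ∫ u in Ioi (0 : ℝ), Real.cosh (u / 2) / 2 * f (Real.sinh (u / 2)) =
      ∫ s in Ioi (0 : ℝ), f s := by
  have himage : (fun u => Real.sinh (u / 2)) '' Ioi (0 : ℝ) = Ioi 0 := by
    ext y
    constructor
    · rintro ⟨u, hu, rfl⟩
      exact Real.sinh_pos_iff.2 (half_pos hu)
    · intro hy
      refine ⟨2 * Real.arsinh y, mul_pos two_pos (Real.arsinh_pos_iff.2 hy), ?_⟩
      simp [Real.sinh_arsinh]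
  have h := integral_image_eq_integral_abs_deriv_smul (s := Ioi (0 : ℝ))
    (f := fun u => Real.sinh (u / 2)) (f' := fun u => Real.cosh (u / 2) / 2) measurableSet_Ioi
    (fun u _ => by
      have h1 := ((hasDerivAt_id u).div_const 2).sinh
      simp only [id, mul_one_div] at h1
      exact h1.hasDerivWithinAt)
    (fun u _ v _ huv => by
      have := Real.sinh_injective huv
      linarith) f
  rw [himage] at h
  rw [h]
  refine setIntegral_congr_fun measurableSet_Ioi fun u _ => ?_
  simp only [smul_eq_mul]
  rw [abs_of_pos (half_pos (Real.cosh_pos _))]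

/-- With `s = sinh (u/2)`, `cosh u = 1 + 2s²`, and the factor `cosh (u/2)` of `cosh ((2k+1)u/2)`
supplies `ds`. What remains is a polynomial in `s²` against a Gaussian; the sign of the order is
immaterial since `cosh` is even. -/
theorem besselK_neg_nat_sub_half (k : ℕ) {x : ℝ} (hx : 0 < x) :
    besselK (-(k : ℝ) - 1 / 2) x = Real.exp (-x) * √Real.pi / √(2 * x) *
      ∑ j ∈ Finset.range (k + 1), ((k + j).factorial : ℝ) /
        (((k - j).factorial : ℝ) * (j.factorial : ℝ) * (2 * x) ^ j) := by
  have h1 : besselK (-(k : ℝ) - 1 / 2) x = ∫ u in Ioi (0 : ℝ), Real.cosh (u / 2) / 2 *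
      (fun s => ∑ j ∈ Finset.range (k + 1), 2 * Real.exp (-x) * ((k + j).choose (2 * j) : ℝ) *
        ((4 * s ^ 2) ^ j * Real.exp (-(2 * x) * s ^ 2))) (Real.sinh (u / 2)) := by
    refine setIntegral_congr_fun measurableSet_Ioi fun u _ => ?_
    have e1 : (-(k : ℝ) - 1 / 2) * u = -((2 * k + 1) * (u / 2)) := by ring
    have e2 : Real.cosh u = 1 + 2 * Real.sinh (u / 2) ^ 2 := by
      rw [show Real.cosh u = Real.cosh (2 * (u / 2)) by ring_nf, Real.cosh_two_mul, Real.cosh_sq]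
      ring
    have e3 : Real.exp (-x * Real.cosh u) =
        Real.exp (-x) * Real.exp (-(2 * x) * Real.sinh (u / 2) ^ 2) := by
      rw [e2, ← Real.exp_add]
      ring_nf
    simp only [e1, Real.cosh_neg, cosh_odd_mul, e3, Finset.mul_sum]
    refine Finset.sum_congr rfl fun j _ => ?_
    ring
  have h2 : (0 : ℝ) < 2 * x := by linarith
  rw [h1, integral_comp_sinh_half (fun s => ∑ j ∈ Finset.range (k + 1),
    2 * Real.exp (-x) * ((k + j).choose (2 * j) : ℝ) *
      ((4 * s ^ 2) ^ j * Real.exp (-(2 * x) * s ^ 2))), integral_finsetSum _ fun j _ =>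
    (integrableOn_even_pow_mul_gaussian h2 j).const_mul _, Finset.mul_sum]
  refine Finset.sum_congr rfl fun j hj => ?_
  rw [integral_const_mul, integral_even_pow_mul_gaussian h2]
  have hjk : j ≤ k := Nat.lt_succ_iff.1 (Finset.mem_range.1 hj)
  have h3 := Nat.choose_mul_factorial_mul_factorial (show 2 * j ≤ k + j by omega)
  rw [show k + j - 2 * j = k - j by omega] at h3
  rw [← h3]
  push_cast
  have h4 : ((k - j).factorial : ℝ) ≠ 0 := by exact_mod_cast (k - j).factorial_ne_zero
  have h5 : (j.factorial : ℝ) ≠ 0 := by exact_mod_cast j.factorial_ne_zero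
  have h6 : √(2 * x) ≠ 0 := (Real.sqrt_pos.2 h2).ne'
  field_simp

theorem besselK_term_eq_besselPoly {γ τ : ℝ} (hγ : 0 < γ) (hτ : 0 < τ) (k : ℕ) :
    τ ^ k * √(γ * τ) * Real.exp (γ * τ / 2) * besselK (-(k : ℝ) - 1 / 2) (1 / 2 * γ * τ) /
      (√Real.pi * (k.factorial : ℝ)) = besselPoly γ k τ := by
  have h0 : 0 < γ * τ := mul_pos hγ hτ
  have e1 : 2 * (1 / 2 * γ * τ) = γ * τ := by ring
  have e2 : -(1 / 2 * γ * τ) = -(γ * τ / 2) := by ring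
  rw [besselK_neg_nat_sub_half k (by positivity), e1, e2, Real.exp_neg, besselPoly]
  have h1 : √(γ * τ) ≠ 0 := (Real.sqrt_pos.2 h0).ne'
  have h2 : √Real.pi ≠ 0 := (Real.sqrt_pos.2 Real.pi_pos).ne'
  have h3 : (k.factorial : ℝ) ≠ 0 := by exact_mod_cast k.factorial_ne_zero
  have h4 : Real.exp (γ * τ / 2) ≠ 0 := (Real.exp_pos _).ne'
  have h5 : ∀ P : ℝ, τ ^ k * √(γ * τ) * Real.exp (γ * τ / 2) *
      ((Real.exp (γ * τ / 2))⁻¹ * √Real.pi / √(γ * τ) * P) / (√Real.pi * (k.factorial : ℝ)) =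
      τ ^ k / (k.factorial : ℝ) * P := by
    intro P
    field_simp
  rw [h5, Finset.mul_sum]
  refine Finset.sum_congr rfl fun j hj => ?_
  have hjk : j ≤ k := Nat.lt_succ_iff.1 (Finset.mem_range.1 hj)
  have h6 := Nat.choose_mul_factorial_mul_factorial (show j ≤ k + j by omega)
  rw [Nat.add_sub_cancel] at h6
  have h7 : ((k - j).factorial : ℝ) ≠ 0 := by exact_mod_cast (k - j).factorial_ne_zero
  have h8 : (j.factorial : ℝ) ≠ 0 := by exact_mod_cast j.factorial_ne_zero
  rw [← h6, show τ ^ k = τ ^ (k - j) * τ ^ j by rw [← pow_add, Nat.sub_add_cancel hjk], mul_pow]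
  push_cast
  field_simp


/-! ### The resolvent of `D + N` and the estimate for positive times. -/

section

variable {n : ℕ} {D N : Matrix (Fin n) (Fin n) ℂ}

theorem IsStrictlyTriangular.neg (hN : IsStrictlyTriangular N) : IsStrictlyTriangular (-N) := by
  simpa [IsStrictlyTriangular] using hN

theorem IsStrictlyTriangular.charpoly_add (hN : IsStrictlyTriangular N) (hD : D.IsDiag) :
    (D + N).charpoly = ∏ i, (Polynomial.X - Polynomial.C (D i i)) := by
  rcases hN with h | h
  · rw [Matrix.charpoly_of_isUpperTriangular]
    · simp [h]
    · intro i j (hij : j < i)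
      rw [Matrix.add_apply, hD hij.ne', h i j hij.le, add_zero]
  · rw [← Matrix.charpoly_transpose, Matrix.charpoly_of_isUpperTriangular]
    · simp [h]
    · intro i j (hij : j < i)
      rw [Matrix.transpose_apply, Matrix.add_apply, hD hij.ne, h j i hij.le, add_zero]

/-- Cayley–Hamilton: the characteristic polynomial is `X^n`. -/
theorem IsStrictlyTriangular.pow_eq_zero (hN : IsStrictlyTriangular N) : N ^ n = 0 := by
  have h1 := hN.charpoly_add (D := 0) Matrix.isDiag_zero
  have h2 := N.aeval_self_charpoly
  rw [zero_add] at h1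
  rw [h1] at h2
  simpa using h2

theorem IsStrictlyTriangular.apply_mem_spectrum (hN : IsStrictlyTriangular N) (hD : D.IsDiag)
    (i : Fin n) : D i i ∈ spectrum ℂ (D + N) := by
  rw [Matrix.mem_spectrum_iff_isRoot_charpoly, hN.charpoly_add hD, Polynomial.IsRoot,
    Polynomial.eval_prod]
  exact Finset.prod_eq_zero (Finset.mem_univ i) (by simp)

/-- The resolvent of the diagonal of `D`. -/
def diagResolvent (D : Matrix (Fin n) (Fin n) ℂ) (z : ℂ) : Matrix (Fin n) (Fin n) ℂ :=
  Matrix.diagonal fun i => (z - D i i)⁻¹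

theorem IsStrictlyTriangular.diagonal_mul (hN : IsStrictlyTriangular N) (v : Fin n → ℂ) :
    IsStrictlyTriangular (Matrix.diagonal v * N) := by
  refine hN.imp (fun h i j hij => ?_) fun h i j hij => ?_ <;>
  rw [Matrix.diagonal_mul, h i j hij, mul_zero]

/-- Factor `z - D - N = (z - D)(1 - M)` with `M` nilpotent; the geometric series for `(1 - M)⁻¹`
stops before `M ^ n`. -/
theorem IsStrictlyTriangular.resolvent_eq_sum (hN : IsStrictlyTriangular N) (hD : D.IsDiag)
    {z : ℂ} (hz : ∀ i, z - D i i ≠ 0) :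
    (z • (1 : Matrix (Fin n) (Fin n) ℂ) - (D + N))⁻¹ =
      ∑ k ∈ Finset.range n, (diagResolvent D z * N) ^ k * diagResolvent D z := by
  refine Matrix.inv_eq_right_inv ?_
  set M := diagResolvent D z * N with hM
  have h1 : (z • (1 : Matrix (Fin n) (Fin n) ℂ) - D) * diagResolvent D z = 1 := by
    have : z • (1 : Matrix (Fin n) (Fin n) ℂ) - D = Matrix.diagonal fun i => z - D i i := by
      ext i j
      by_cases hij : i = j
      · subst hij
        simp
      · simp [Matrix.one_apply_ne hij, Matrix.diagonal_apply_ne _ hij, hD hij]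
    rw [this, diagResolvent, Matrix.diagonal_mul_diagonal, ← Matrix.diagonal_one]
    congr 1
    ext i
    exact mul_inv_cancel₀ (hz i)
  have h2 : z • (1 : Matrix (Fin n) (Fin n) ℂ) - (D + N) =
      (z • (1 : Matrix (Fin n) (Fin n) ℂ) - D) * (1 - M) := by
    rw [mul_sub, mul_one, hM, ← mul_assoc, h1, one_mul]
    abel
  have h3 : M ^ n = 0 := (hN.diagonal_mul _).pow_eq_zero
  rw [h2, ← Finset.sum_mul, mul_assoc, ← mul_assoc (1 - M), mul_neg_geom_sum, h3, sub_zero,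
    one_mul, h1]

theorem diagResolvent_mul_pow_succ_apply (D N : Matrix (Fin n) (Fin n) ℂ) (z : ℂ) (k : ℕ)
    (i j : Fin n) :
    ((diagResolvent D z * N) ^ (k + 1) * diagResolvent D z) i j =
      (z - D i i)⁻¹ * ∑ l, N i l * ((diagResolvent D z * N) ^ k * diagResolvent D z) l j := by
  rw [pow_succ', mul_assoc, Matrix.mul_apply, Finset.mul_sum]
  refine Finset.sum_congr rfl fun l _ => ?_
  rw [diagResolvent, Matrix.diagonal_mul, mul_assoc]

variable {Γ : Contour} {S : Set ℂ}

theorem Contour.Encloses.continuousOn_resolvent_term (h : Γ.Encloses S) (hDS : ∀ i, D i i ∈ S)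
    (k : ℕ) (i j : Fin n) :
    ContinuousOn (fun z => ((diagResolvent D z * N) ^ k * diagResolvent D z) i j) Γ.image := by
  have hinv : ∀ i, ContinuousOn (fun z => (z - D i i)⁻¹) Γ.image := fun i =>
    ContinuousOn.inv₀ (by fun_prop) fun z hz => h.ne_of_mem hz (hDS i)
  induction k generalizing i with
  | zero =>
    simp only [pow_zero, one_mul, diagResolvent, Matrix.diagonal_apply]
    split_ifs
    · exact hinv i
    · exact continuousOn_const
  | succ k ih =>
    simp only [diagResolvent_mul_pow_succ_apply]
    exact (hinv i).mul (continuousOn_finsetSum _ fun l _ => continuousOn_const.mul (ih l))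

/-- The multiset `X` records the diagonal entries already visited by a path. Carrying it through the
induction lets each step move one factor `(z - D i i)⁻¹` into `leftProd`, while `X.card + k` stays
fixed. -/
theorem Contour.Encloses.norm_integral_resolvent_term_le (h : Γ.Encloses S) {α β : ℝ}
    (hα : 0 < α) (hβ : 0 < β) (hS : ∀ d ∈ S, d.re ≤ -α ∨ β ≤ d.re) (hDS : ∀ i, D i i ∈ S)
    {τ : ℝ} (hτ : 0 < τ) (k : ℕ) (i j : Fin n) (X : Multiset ℂ) (hX : ∀ d ∈ X, d ∈ S) :
    ‖(2 * Real.pi * Complex.I)⁻¹ * Γ.integral fun z => Complex.exp (z * τ) * leftProd X z *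
        ((diagResolvent D z * N) ^ k * diagResolvent D z) i j‖ ≤
      (absMatrix N ^ k) i j *
        (Real.exp (-α * τ) * besselPoly (α + β) (X.card + k) τ) := by
  induction k generalizing i X with
  | zero =>
    simp only [pow_zero, one_mul, diagResolvent]
    by_cases hij : i = j
    · subst hij
      have h1 := h.norm_leftResidue_le hα hβ hS (X := D i i ::ₘ X)
        (by simpa [hDS i] using hX) hτ
      simp only [Matrix.diagonal_apply_eq, Matrix.one_apply_eq, one_mul, add_zero]
      simp only [leftResidue, Multiset.card_cons, residueBound, leftProd_cons] at h1
      simpa only [mul_assoc, mul_comm (leftProd X _)] using h1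
    · simp [Matrix.diagonal_apply_ne _ hij, Matrix.one_apply_ne hij, Contour.integral,
        ClosedCurve.integral]
  | succ k ih =>
    have hX' : ∀ d ∈ D i i ::ₘ X, d ∈ S := by simpa [hDS i] using hX
    have h1 : (Γ.integral fun z => Complex.exp (z * τ) * leftProd X z *
        ((diagResolvent D z * N) ^ (k + 1) * diagResolvent D z) i j) =
        ∑ l, N i l * Γ.integral fun z => Complex.exp (z * τ) * leftProd (D i i ::ₘ X) z *
          ((diagResolvent D z * N) ^ k * diagResolvent D z) l j := by
      simp only [← Γ.integral_const_mul]
      rw [← Γ.integral_finset_sum _ fun l _ => ContinuousOn.fun_mul continuousOn_const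
        ((h.continuousOn_exp_mul_leftProd hX' τ).fun_mul
          (h.continuousOn_resolvent_term hDS k l j))]
      congr 1
      ext z
      rw [diagResolvent_mul_pow_succ_apply, leftProd_cons, Finset.mul_sum, Finset.mul_sum]
      refine Finset.sum_congr rfl fun l _ => ?_
      ring
    rw [h1, Finset.mul_sum, pow_succ', Matrix.mul_apply, Finset.sum_mul]
    refine (norm_sum_le _ _).trans (Finset.sum_le_sum fun l _ => ?_)
    rw [mul_left_comm, norm_mul, mul_assoc (absMatrix N i l)]
    refine mul_le_mul_of_nonneg_left ?_ (norm_nonneg (N i l))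
    have h2 := ih l (D i i ::ₘ X) hX'
    rwa [Multiset.card_cons, show X.card + 1 + k = X.card + (k + 1) by ring] at h2

theorem Contour.Encloses.norm_green_le_of_pos (hN : IsStrictlyTriangular N) (hD : D.IsDiag)
    (h : Γ.Encloses (spectrum ℂ (D + N))) {α β : ℝ} (hα : 0 < α) (hβ : 0 < β)
    (hS : ∀ d ∈ spectrum ℂ (D + N), d.re ≤ -α ∨ β ≤ d.re) {τ : ℝ} (hτ : 0 < τ) (i j : Fin n) :
    ‖green Γ (D + N) τ i j‖ ≤ Real.exp (-α * τ) *
      ∑ k ∈ Finset.range n, besselPoly (α + β) k τ * (absMatrix N ^ k) i j := by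
  have hDS := hN.apply_mem_spectrum hD
  have h0 : ∀ d ∈ (0 : Multiset ℂ), d ∈ spectrum ℂ (D + N) := by simp
  have h1 : Γ.integral (fun z => g τ z *
      (z • (1 : Matrix (Fin n) (Fin n) ℂ) - (D + N))⁻¹ i j) =
      ∑ k ∈ Finset.range n, Γ.integral fun z => Complex.exp (z * τ) * leftProd 0 z *
        ((diagResolvent D z * N) ^ k * diagResolvent D z) i j := by
    rw [← Γ.integral_finset_sum _ fun k _ => (h.continuousOn_exp_mul_leftProd h0 τ).fun_mul
      (h.continuousOn_resolvent_term hDS k i j)]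
    refine Γ.integral_congr fun z hz => ?_
    have hg : g τ z = Complex.exp (z * τ) * leftProd 0 z := by
      simp [g, expPlus, expMinus, leftProd, hτ]
    simp only [hg, hN.resolvent_eq_sum hD fun i => h.ne_of_mem hz (hDS i), Matrix.sum_apply,
      Finset.mul_sum]
  rw [green, Matrix.of_apply, h1, Finset.mul_sum, Finset.mul_sum]
  refine (norm_sum_le _ _).trans (Finset.sum_le_sum fun k _ => ?_)
  have h2 := h.norm_integral_resolvent_term_le (N := N) hα hβ hS hDS hτ k i j 0 h0
  rw [Multiset.card_zero, zero_add] at h2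
  refine h2.trans_eq ?_
  ring

/-! ### Reduction of negative times to positive times. -/

theorem matrix_inv_neg (M : Matrix (Fin n) (Fin n) ℂ) : (-M)⁻¹ = -M⁻¹ := by
  by_cases h : IsUnit M.det
  · exact Matrix.inv_eq_right_inv (by rw [neg_mul_neg, Matrix.mul_nonsing_inv _ h])
  · have h' : ¬IsUnit (-M).det := by
      rwa [← Matrix.isUnit_iff_isUnit_det, IsUnit.neg_iff, Matrix.isUnit_iff_isUnit_det]
    rw [Matrix.nonsing_inv_apply_not_isUnit _ h, Matrix.nonsing_inv_apply_not_isUnit _ h', neg_zero]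

/-- Under `z ↦ -z` the scalar function, the resolvent and `dz` each change sign, leaving one minus
sign. -/
theorem Contour.Encloses.green_reflect {A : Matrix (Fin n) (Fin n) ℂ} (h : Γ.Encloses S)
    {t : ℝ} (ht : t ≠ 0) : green Γ.reflect (-A) (-t) = -green Γ A t := by
  ext i j
  rw [Matrix.neg_apply, green, green, Matrix.of_apply, Matrix.of_apply, Γ.reflect_integral,
    mul_neg, neg_inj]
  congr 1
  refine Γ.integral_congr fun z hz => ?_
  have h1 : g (-t) (-z) = -g t z := by
    have hre := h.re_ne_zero_of_mem hz
    rcases lt_or_gt_of_ne hre with hz' | hz' <;> rcases lt_or_gt_of_ne ht with ht' | ht' <;>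
    simp [g, expPlus, expMinus, hz', hz'.not_gt, ht', ht'.not_gt]
  have h2 : (-z) • (1 : Matrix (Fin n) (Fin n) ℂ) - -A =
      -(z • (1 : Matrix (Fin n) (Fin n) ℂ) - A) := by
    rw [neg_smul, neg_sub_neg, neg_sub]
  simp only [h1, h2, matrix_inv_neg, Matrix.neg_apply, neg_mul_neg]

theorem absMatrix_neg (A : Matrix (Fin n) (Fin n) ℂ) : absMatrix (-A) = absMatrix A := by
  ext i j
  simp [absMatrix]

end

end GreenEstimate

end

open GreenEstimate in
theorem corollary5 {n : ℕ} (B D N : Matrix (Fin n) (Fin n) ℂ)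
    (hB : B = D + N) (hD : D.IsDiag) (hN : GreenEstimate.IsStrictlyTriangular N)
    (γm γp : ℝ) (hγm : 0 < γm) (hγp : 0 < γp)
    (hstrip : Disjoint {z : ℂ | -γm < z.re ∧ z.re < γp} (spectrum ℂ B))
    (Γ : GreenEstimate.Contour) (hΓ : Γ.Encloses (spectrum ℂ B))
    (γ : ℝ) (hγ : γ = γm + γp) (t : ℝ) (ht : t ≠ 0) :
    ∀ i j : Fin n,
      GreenEstimate.absMatrix (GreenEstimate.green Γ B t) i j ≤
        ((GreenEstimate.heaviside t * Real.exp (-γm * t) +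
            GreenEstimate.heaviside (-t) * Real.exp (γp * t)) •
          ∑ k ∈ Finset.range n,
            (|t| ^ k * √(γ * |t|) * Real.exp (γ * |t| / 2) *
                GreenEstimate.besselK (-(k : ℝ) - 1 / 2) (1 / 2 * γ * |t|) /
              (√Real.pi * (Nat.factorial k : ℝ))) •
              GreenEstimate.absMatrix N ^ k) i j := by
  intro i j
  subst hB hγ
  have hS : ∀ d ∈ spectrum ℂ (D + N), d.re ≤ -γm ∨ γp ≤ d.re := by
    intro d hd
    by_contra hcon
    push Not at hcon
    exact Set.disjoint_left.1 hstrip hcon hd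
  have hγ : 0 < γm + γp := add_pos hγm hγp
  simp only [besselK_term_eq_besselPoly hγ (abs_pos.2 ht), Matrix.smul_apply, Matrix.sum_apply,
    smul_eq_mul, absMatrix, Matrix.map_apply]
  rcases lt_or_gt_of_ne ht with ht' | ht'
  -- For `t < 0`, the positive-time bound is applied to `-D + -N` at time `-t`, with `γp` and `γm`
  -- interchanged.
  · have hr := hΓ.reflect
    rw [spectrum.neg_eq, neg_add] at hr
    have hS' : ∀ d ∈ spectrum ℂ (-D + -N), d.re ≤ -γp ∨ γm ≤ d.re := by
      intro d hd
      rw [← neg_add, ← spectrum.neg_eq] at hd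
      rcases hS _ hd with h | h
      · right
        rw [Complex.neg_re] at h
        linarith
      · left
        rw [Complex.neg_re] at h
        linarith
    have h1 := hr.norm_green_le_of_pos hN.neg hD.neg hγp hγm hS' (neg_pos.2 ht') i j
    rw [← neg_add, hΓ.green_reflect ht, Matrix.neg_apply, norm_neg, absMatrix_neg,
      add_comm γp γm, neg_mul_neg] at h1
    simpa [heaviside, ht', ht'.not_gt, abs_of_neg ht', absMatrix] using h1
  · have h1 := hΓ.norm_green_le_of_pos hN hD hγm hγp hS ht' i j
    simpa [heaviside, ht', ht'.not_gt, abs_of_pos ht', absMatrix] using h1
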